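/- Let $(\Omega,d_\Omega)$, $(\mathcal S,d_{\mathcal S})$, $(\mathcal A,d_{\mathcal A})$ be metric spaces, $\mathcal S,\mathcal A$ with their Borel $\sigma$-algebras, and equip $\mathcal S\times\mathcal A$ with $d_{\mathcal S\times\mathcal A}=d_{\mathcal S}+d_{\mathcal A}$. For each context $\omega\in\Omega$ let $\mathcal M_\omega=\langle\mathcal S,\mathcal A,P_\omega,R_\omega,\gamma,\mu\rangle$ be a Markov decision process with transition kernel $P_\omega$, measurable reward with $|R_\omega|\le R_{\max}$, and common discount factor $\gamma\in[0,1)$ and initial distribution $\mu$. Let $\Theta\subseteq\mathbb R^m$ be open, with $d_\Theta$ the Euclidean distance, and let $\pi_\theta(\cdot\mid s)$, $\theta\in\Theta$, be policies given by positive, jointly measurable densities with respect to a $\sigma$-finite measure on $\mathcal A$. Write $Q_\omega^\theta(s,a)=\mathbb E[\sum_{t\ge0}\gamma^tR_\omega(s_t,a_t)\mid s_0=s,a_0=a]$, $V_\omega^\theta(s)=\mathbb E_{a\sim\pi_\theta(\cdot\mid s)}[Q_\omega^\theta(s,a)]$, let $\delta_{\mu,\omega}^\theta=(1-\gamma)\sum_{t\ge0}\gamma^t\,\mathrm{Law}(s_t)$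 be the discounted state occupancy measure for $s_0\sim\mu$, and let $j_\omega(\theta)=(1-\gamma)\,\mathbb E_{s_0\sim\mu}[V_\omega^\theta(s_0)]$ be the (normalized) expected return. Let $\mathcal K(p,q)=\sup_f|\int f\,dp-\int f\,dq|$, over $1$-Lipschitz $f$ integrable for $p$ and $q$, be the Kantorovich distance. Assume, with non-negative Lipschitz constants, for all $\omega,\widehat\omega\in\Omega$, $s,s'\in\mathcal S$, $a,a'\in\mathcal A$, $\theta,\theta'\in\Theta$ and $i=1,\dots,m$: 1. $\mathcal K(P_\omega(\cdot\mid s,a),P_\omega(\cdot\mid s',a'))\le L_P(\omega)\,d_{\mathcal S\times\mathcal A}((s,a),(s',a'))$ and $|R_\omega(s,a)-R_\omega(s',a')|\le L_r(\omega)\,d_{\mathcal S\times\mathcal A}((s,a),(s',a'))$; 2. $\mathcal K(P_\omega(\cdot\mid s,a),P_{\widehat\omega}(\cdot\mid s,a))\le L_{\omega_P}d_\Omega(\omega,\widehat\omega)$ and $|R_\omega(s,a)-R_{\widehat\omega}(s,a)|\le L_{\omega_r}d_\Omega(\omega,\widehat\omega)$; 3. $\mathcal K(\pi_\theta(\cdot\mid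 s),\pi_\theta(\cdot\mid s'))\le L_{\pi_\theta}d_{\mathcal S}(s,s')$ and $\mathcal K(\pi_\theta(\cdot\mid s),\pi_{\theta'}(\cdot\mid s))\le L_\pi(\theta)d_\Theta(\theta,\theta')$; 4. the partial derivatives $\nabla_{\theta_i}\log\pi_\theta(a\mid s)$ exist, $|\nabla_{\theta_i}\log\pi_\theta(a\mid s)|\le M_\theta^i$, $|\nabla_{\theta_i}\log\pi_\theta(a\mid s)-\nabla_{\theta_i}\log\pi_\theta(a'\mid s')|\le L^i_{\nabla\log\pi_\theta}d_{\mathcal S\times\mathcal A}((s,a),(s',a'))$ and $|\nabla_{\theta_i}\log\pi_\theta(a\mid s)-\nabla_{\theta_i}\log\pi_{\theta'}(a\mid s)|\le L^i_{\nabla\log\pi}(\theta)\,d_\Theta(\theta,\theta')$. Let $\theta\in\Theta$, let $\omega\in\Omega$ be such that $\gamma L_P(\omega)(1+L_{\pi_\theta})<1$, and let $1\le i\le m$. Then, for every context $\omega'\in\Omega$, the partial derivative $\nabla_{\theta_i}j_{\omega'}(\theta)$ exists and equals $\mathbb E_{s\sim\delta_{\mu,\omega'}^\theta,\,a\sim\pi_\theta(\cdot\mid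 s)}[\nabla_{\theta_i}\log\pi_\theta(a\mid s)\,Q_{\omega'}^\theta(s,a)]$, and for every $\widehat\omega\in\Omega$ $$\left|\nabla_{\theta_i}j_\omega(\theta)-\nabla_{\theta_i}j_{\widehat\omega}(\theta)\right|\le L_{\nabla j}(\omega)\,d_\Omega(\omega,\widehat\omega),\qquad L_{\nabla j}(\omega)=L^i_{\eta}(\omega)\,(1+L_{\pi_\theta})\,L_\delta(\omega)+M_\theta^i\,L_{\omega_Q},$$ where $$L_Q(\omega)=\frac{L_r(\omega)}{1-\gamma L_P(\omega)(1+L_{\pi_\theta})},\quad L_V(\omega)=L_Q(\omega)(1+L_{\pi_\theta}),\quad L_{\omega_Q}=\frac{L_{\omega_r}+\gamma L_{\omega_P}L_V(\omega)}{1-\gamma},$$ $$L_\delta(\omega)=\frac{\gamma L_{\omega_P}}{1-\gamma L_P(\omega)(1+L_{\pi_\theta})},\quad L^i_\eta(\omega)=\frac{R_{\max}}{1-\gamma}L^i_{\nabla\log\pi_\theta}+M_\theta^iL_Q(\omega).$$ -/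

import Mathlib

open MeasureTheory ProbabilityTheory
open scoped NNReal ENNReal

noncomputable section

/-- Kantorovich (`L¹`-Wasserstein) distance of two measures in its dual form: the supremum of
`|∫ f dp - ∫ f dq|` over all `1`-Lipschitz real functions `f` for which both integrals exist. -/
def kantorovich {X : Type*} [MetricSpace X] [MeasurableSpace X] (p q : Measure X) : ℝ≥0∞ :=
  ⨆ (f : X → ℝ) (_ : LipschitzWith 1 f) (_ : Integrable f p) (_ : Integrable f q),
    ‖(∫ x, f x ∂p) - ∫ x, f x ∂q‖ₑ

/-- A contextual Markov decision process: a family of MDPs indexed by the context, with common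
state space, action space, discount factor and initial distribution, and bounded rewards. -/
structure CMDP (Ω S A : Type*) [MeasurableSpace S] [MeasurableSpace A] where
  /-- transition kernels `P_ω(· | s, a)` -/
  P : Ω → Kernel (S × A) S
  markov_P : ∀ ω, IsMarkovKernel (P ω)
  /-- reward functions `R_ω(s, a)` -/
  R : Ω → S × A → ℝ
  measurable_R : ∀ ω, Measurable (R ω)
  /-- common bound of the rewards -/
  Rmax : ℝ
  abs_R_le : ∀ ω x, |R ω x| ≤ Rmax
  /-- discount factor -/
  γ : ℝ
  γ_nonneg : 0 ≤ γ
  γ_lt_one : γ < 1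
  /-- initial state distribution -/
  μ : Measure S
  prob_μ : IsProbabilityMeasure μ

/-- A parametric family of stationary Markovian policies, given by positive probability densities
`π_θ(a | s)` with respect to a reference measure on the action space, for `θ` in an open set of
`ℝᵐ`. (Values of `density` for `θ` outside of `Θ` play no role.) -/
structure ParametricPolicy (m : ℕ) (S A : Type*) [MeasurableSpace S] [MeasurableSpace A] where
  /-- parameter space -/
  Θ : Set (EuclideanSpace ℝ (Fin m))
  isOpen_Θ : IsOpen Θ
  /-- reference measure for the densities (for instance Lebesgue or counting measure) -/
  ref : Measure A
  sigmaFinite_ref : SigmaFinite ref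
  /-- the density `π_θ(a | s)` -/
  density : EuclideanSpace ℝ (Fin m) → S → A → ℝ
  measurable_density : ∀ θ ∈ Θ, Measurable (Function.uncurry (density θ))
  density_pos : ∀ θ ∈ Θ, ∀ s a, 0 < density θ s a
  lintegral_density : ∀ θ ∈ Θ, ∀ s, ∫⁻ a, ENNReal.ofReal (density θ s a) ∂ref = 1

namespace ParametricPolicy

variable {m : ℕ} {S A : Type*} [MeasurableSpace S] [MeasurableSpace A]

/-- The policy `π_θ(· | s)` as a kernel from states to actions. -/
def kernel (π : ParametricPolicy m S A) (θ : EuclideanSpace ℝ (Fin m)) : Kernel S A :=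
  haveI := π.sigmaFinite_ref
  Kernel.withDensity (Kernel.const S π.ref) (fun s a => ENNReal.ofReal (π.density θ s a))

/-- The log-density `θ ↦ log π_θ(a | s)`. -/
def logDensity (π : ParametricPolicy m S A) (s : S) (a : A)
    (θ : EuclideanSpace ℝ (Fin m)) : ℝ :=
  Real.log (π.density θ s a)

/-- The `i`-th component of the score `∇_θ log π_θ(a | s)`. -/
def score (π : ParametricPolicy m S A) (i : Fin m) (θ : EuclideanSpace ℝ (Fin m))
    (s : S) (a : A) : ℝ :=
  lineDeriv ℝ (π.logDensity s a) θ (EuclideanSpace.single i 1)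

end ParametricPolicy

namespace CMDP

section values

variable {Ω S A : Type*} [MeasurableSpace S] [MeasurableSpace A] {m : ℕ}

/-- One step of the state-action chain: `(s, a) ↦ (s', a')`, `s' ∼ P_ω(· | s, a)`,
`a' ∼ π_θ(· | s')`. -/
def stepSA (M : CMDP Ω S A) (π : ParametricPolicy m S A) (ω : Ω)
    (θ : EuclideanSpace ℝ (Fin m)) : Kernel (S × A) (S × A) :=
  (Kernel.id ×ₖ π.kernel θ) ∘ₖ M.P ω

/-- The law of `(s_t, a_t)` given `(s_0, a_0)`. -/
def nStepSA (M : CMDP Ω S A) (π : ParametricPolicy m S A) (ω : Ω)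
    (θ : EuclideanSpace ℝ (Fin m)) : ℕ → Kernel (S × A) (S × A)
  | 0 => Kernel.id
  | t + 1 => M.stepSA π ω θ ∘ₖ M.nStepSA π ω θ t

/-- The action-value function `Q_ω^θ(s, a) = ∑ₜ γᵗ E[R_ω(s_t, a_t) | s_0 = s, a_0 = a]`
(an absolutely convergent series, the rewards being bounded). -/
def Q (M : CMDP Ω S A) (π : ParametricPolicy m S A) (ω : Ω)
    (θ : EuclideanSpace ℝ (Fin m)) (s : S) (a : A) : ℝ :=
  ∑' t : ℕ, M.γ ^ t * ∫ x, M.R ω x ∂(M.nStepSA π ω θ t (s, a))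

/-- The state-value function `V_ω^θ(s) = E_{a ∼ π_θ(· | s)}[Q_ω^θ(s, a)]`. -/
def V (M : CMDP Ω S A) (π : ParametricPolicy m S A) (ω : Ω)
    (θ : EuclideanSpace ℝ (Fin m)) (s : S) : ℝ :=
  ∫ a, M.Q π ω θ s a ∂(π.kernel θ s)

/-- The expected (unnormalized) discounted return `j_ω(θ) = E_{s_0 ∼ μ}[V_ω^θ(s_0)]`. -/
def expectedReturn (M : CMDP Ω S A) (π : ParametricPolicy m S A) (ω : Ω)
    (θ : EuclideanSpace ℝ (Fin m)) : ℝ :=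
  ∫ s, M.V π ω θ s ∂M.μ

/-- One step of the state chain: `a ∼ π_θ(· | s)`, `s' ∼ P_ω(· | s, a)`. -/
def stepS (M : CMDP Ω S A) (π : ParametricPolicy m S A) (ω : Ω)
    (θ : EuclideanSpace ℝ (Fin m)) : Kernel S S :=
  M.P ω ∘ₖ (Kernel.id ×ₖ π.kernel θ)

/-- The law of the state `s_t` when `s_0 ∼ μ`. -/
def stateLaw (M : CMDP Ω S A) (π : ParametricPolicy m S A) (ω : Ω)
    (θ : EuclideanSpace ℝ (Fin m)) : ℕ → Measure S
  | 0 => M.μ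
  | t + 1 => (M.stateLaw π ω θ t).bind (M.stepS π ω θ)

/-- The `γ`-discounted state occupancy measure
`δ_{μ,ω}^θ = (1 - γ) ∑ₜ γᵗ Law(s_t)`. -/
def occupancy (M : CMDP Ω S A) (π : ParametricPolicy m S A) (ω : Ω)
    (θ : EuclideanSpace ℝ (Fin m)) : Measure S :=
  ENNReal.ofReal (1 - M.γ) •
    Measure.sum (fun t : ℕ => ENNReal.ofReal (M.γ ^ t) • M.stateLaw π ω θ t)

/-- `η_{i,ω}^θ(s, a) = ∇_{θ_i} log π_θ(a | s) · Q_ω^θ(s, a)`. -/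
def eta (M : CMDP Ω S A) (π : ParametricPolicy m S A) (i : Fin m) (ω : Ω)
    (θ : EuclideanSpace ℝ (Fin m)) (s : S) (a : A) : ℝ :=
  π.score i θ s a * M.Q π ω θ s a

/-- The policy gradient `E_{s ∼ δ_{μ,ω}^θ, a ∼ π_θ(· | s)}[∇_{θ_i} log π_θ(a | s) Q_ω^θ(s, a)]`,
`i`-th component. -/
def policyGradient (M : CMDP Ω S A) (π : ParametricPolicy m S A) (i : Fin m) (ω : Ω)
    (θ : EuclideanSpace ℝ (Fin m)) : ℝ :=
  ∫ s, ∫ a, M.eta π i ω θ s a ∂(π.kernel θ s) ∂(M.occupancy π ω θ)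

end values

section lipschitz

variable {Ω S A : Type*} [MetricSpace S] [MeasurableSpace S] [MetricSpace A] [MeasurableSpace A]

/-- Every MDP of the family is `(L_P(ω), L_r(ω))`-Lipschitz; the metric on state-action pairs is
`d_S + d_A`. -/
structure IsLipschitz (M : CMDP Ω S A) (LP Lr : Ω → ℝ≥0) : Prop where
  transition : ∀ ω s s' a a',
    kantorovich (M.P ω (s, a)) (M.P ω (s', a')) ≤ LP ω * (edist s s' + edist a a')
  reward : ∀ ω s s' a a',
    |M.R ω (s, a) - M.R ω (s', a')| ≤ Lr ω * (dist s s' + dist a a')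

/-- The family of MDPs is `(L_{ωP}, L_{ωr})`-Lipschitz in the context. -/
structure IsContextLipschitz [MetricSpace Ω] (M : CMDP Ω S A) (LωP Lωr : ℝ≥0) : Prop where
  transition : ∀ ω ω' s a,
    kantorovich (M.P ω (s, a)) (M.P ω' (s, a)) ≤ LωP * edist ω ω'
  reward : ∀ ω ω' s a,
    |M.R ω (s, a) - M.R ω' (s, a)| ≤ Lωr * dist ω ω'

end lipschitz

end CMDP

namespace ParametricPolicy

variable {m : ℕ} {S A : Type*} [MetricSpace S] [MeasurableSpace S]
  [MetricSpace A] [MeasurableSpace A]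

/-- The policy is Lipschitz in the state, with constant `L_{π_θ}`, and in the parameter, with
constant `L_π(θ)`. -/
structure IsLipschitz (π : ParametricPolicy m S A)
    (Lstate Lparam : EuclideanSpace ℝ (Fin m) → ℝ≥0) : Prop where
  state : ∀ θ ∈ π.Θ, ∀ s s',
    kantorovich (π.kernel θ s) (π.kernel θ s') ≤ Lstate θ * edist s s'
  param : ∀ s, ∀ θ ∈ π.Θ, ∀ θ' ∈ π.Θ,
    kantorovich (π.kernel θ s) (π.kernel θ' s) ≤ Lparam θ * edist θ θ'

/-- The partial derivatives `∇_{θ_i} log π_θ(a | s)` exist, are bounded by `M_θ^i`, Lipschitz in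
the state-action pair with constant `Lsa θ i`, and Lipschitz in the parameter with constant
`Lparam θ i`. -/
structure HasLipschitzScore (π : ParametricPolicy m S A)
    (B : EuclideanSpace ℝ (Fin m) → Fin m → ℝ)
    (Lsa Lparam : EuclideanSpace ℝ (Fin m) → Fin m → ℝ≥0) : Prop where
  differentiable : ∀ θ ∈ π.Θ, ∀ i s a,
    LineDifferentiableAt ℝ (π.logDensity s a) θ (EuclideanSpace.single i 1)
  bounded : ∀ θ ∈ π.Θ, ∀ i s a, |π.score i θ s a| ≤ B θ i
  stateAction : ∀ θ ∈ π.Θ, ∀ i s s' a a',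
    |π.score i θ s a - π.score i θ s' a'| ≤ Lsa θ i * (dist s s' + dist a a')
  param : ∀ θ ∈ π.Θ, ∀ θ' ∈ π.Θ, ∀ i s a,
    |π.score i θ s a - π.score i θ' s a| ≤ Lparam θ i * dist θ θ'

end ParametricPolicy

/-- `L_Q = L_r / (1 - γ L_P (1 + L_π))`. -/
def lipQ (γ LP Lr Lπ : ℝ) : ℝ := Lr / (1 - γ * LP * (1 + Lπ))

/-- `L_V = L_Q (1 + L_π)`. -/
def lipV (γ LP Lr Lπ : ℝ) : ℝ := lipQ γ LP Lr Lπ * (1 + Lπ)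

/-- `L_{ωQ} = (L_{ωr} + γ L_{ωP} L_V) / (1 - γ)`. -/
def lipCtxQ (γ LP Lr Lπ LωP Lωr : ℝ) : ℝ := (Lωr + γ * LωP * lipV γ LP Lr Lπ) / (1 - γ)

/-- `L_δ = γ L_{ωP} / (1 - γ L_P (1 + L_π))`. -/
def lipDelta (γ LP Lπ LωP : ℝ) : ℝ := γ * LωP / (1 - γ * LP * (1 + Lπ))

/-- `L_η = (R_max / (1 - γ)) L_{∇log π} + B L_Q`, where `B` is the bound of the score. -/
def lipEta (γ Rmax LP Lr Lπ B Lscore : ℝ) : ℝ :=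
  Rmax / (1 - γ) * Lscore + B * lipQ γ LP Lr Lπ

/-- `L_{∇j} = L_η (1 + L_π) L_δ + B L_{ωQ}`. -/
def lipGrad (γ Rmax LP Lr Lπ LωP Lωr B Lscore : ℝ) : ℝ :=
  lipEta γ Rmax LP Lr Lπ B Lscore * (1 + Lπ) * lipDelta γ LP Lπ LωP
    + B * lipCtxQ γ LP Lr Lπ LωP Lωr

end

/-!
All constants come from one principle: `Q` and the potential of the state chain are discounted sums
`G = ∑ₜ γᵗ κᵗ g`, the fixed points of the `γ`-contractions `G ↦ g + γ κ G`. A `k`-Lipschitz kernel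
with `γ k < 1` makes `G` Lipschitz with constant `Lip g / (1 - γ k)`, and if `(κ', g')` replaces
`(κ, g)`, then the residual of `G` in the new equation, divided by `1 - γ`, bounds the change of
`G`. Only `G` itself, not its perturbation, has to be Lipschitz for this. The occupancy measure
inverts `1 - γ T`, in the sense that `∫ (f - γ T f) dδ = (1 - γ) ∫ f dμ`; testing the occupancy of
the perturbed context against the potential of the other one compares the two occupancies.

The same identity applied to `V^θ' - V^θ` writes `(1 - γ) (j(θ') - j(θ))` as the integral of
`Q^θ' (π_θ' / π_θ - 1)` over the state-action occupancy of `θ`. Dividing by the increment of `θ` and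
passing to the limit by dominated convergence gives the policy gradient.
-/

open Filter Topology

/-- A measurable real function bounded in absolute value by `C`; the bound is a parameter so that
it can be tracked through integration. -/
structure IsBoundedMeasurable {X : Type*} [MeasurableSpace X] (f : X → ℝ) (C : ℝ) : Prop where
  measurable : Measurable f
  abs_le : ∀ x, |f x| ≤ C

namespace IsBoundedMeasurable

variable {X Y : Type*} [MeasurableSpace X] [MeasurableSpace Y] {f g : X → ℝ} {C D : ℝ}

theorem integrable (hf : IsBoundedMeasurable f C) (μ : Measure X) [IsFiniteMeasure μ] :
    Integrable f μ :=
  Integrable.of_bound hf.measurable.aestronglyMeasurable C (ae_of_all _ hf.abs_le)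

theorem abs_integral_le (hf : IsBoundedMeasurable f C) (μ : Measure X) [IsProbabilityMeasure μ] :
    |∫ x, f x ∂μ| ≤ C := by
  simpa using norm_integral_le_of_norm_le_const (μ := μ) (f := f) (ae_of_all _ hf.abs_le)

theorem abs_integral_sub_le (hf : IsBoundedMeasurable f C) (hg : IsBoundedMeasurable g D)
    {ε : ℝ} (h : ∀ x, |f x - g x| ≤ ε) (μ : Measure X) [IsProbabilityMeasure μ] :
    |∫ x, f x ∂μ - ∫ x, g x ∂μ| ≤ ε := by
  rw [← integral_sub (hf.integrable μ) (hg.integrable μ)]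
  exact abs_integral_le ⟨hf.measurable.sub hg.measurable, h⟩ μ

theorem sub (hf : IsBoundedMeasurable f C) (hg : IsBoundedMeasurable g D) :
    IsBoundedMeasurable (fun x => f x - g x) (C + D) :=
  ⟨hf.measurable.sub hg.measurable,
    fun x => (abs_sub _ _).trans (add_le_add (hf.abs_le x) (hg.abs_le x))⟩

theorem mul (hf : IsBoundedMeasurable f C) (hg : IsBoundedMeasurable g D) :
    IsBoundedMeasurable (fun x => f x * g x) (C * D) := by
  refine ⟨hf.measurable.mul hg.measurable, fun x => ?_⟩
  rw [abs_mul]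
  exact mul_le_mul (hf.abs_le x) (hg.abs_le x) (abs_nonneg _) ((abs_nonneg _).trans (hf.abs_le x))

theorem const_mul (hf : IsBoundedMeasurable f C) (c : ℝ) :
    IsBoundedMeasurable (fun x => c * f x) (|c| * C) := by
  refine ⟨hf.measurable.const_mul c, fun x => ?_⟩
  rw [abs_mul]
  exact mul_le_mul_of_nonneg_left (hf.abs_le x) (abs_nonneg c)

theorem comp (hf : IsBoundedMeasurable f C) {φ : Y → X} (hφ : Measurable φ) :
    IsBoundedMeasurable (fun y => f (φ y)) C :=
  ⟨hf.measurable.comp hφ, fun y => hf.abs_le (φ y)⟩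

theorem integral_kernel (hf : IsBoundedMeasurable f C) (κ : Kernel Y X) [IsMarkovKernel κ] :
    IsBoundedMeasurable (fun y => ∫ x, f x ∂(κ y)) C :=
  ⟨hf.measurable.stronglyMeasurable.integral_kernel.measurable, fun y => hf.abs_integral_le (κ y)⟩

theorem integral_kernel_prod {f : Y × X → ℝ} (hf : IsBoundedMeasurable f C)
    (κ : Kernel Y X) [IsMarkovKernel κ] :
    IsBoundedMeasurable (fun y => ∫ x, f (y, x) ∂(κ y)) C :=
  ⟨hf.measurable.stronglyMeasurable.integral_kernel_prod_right'.measurable,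
    fun y => (hf.comp measurable_prodMk_left).abs_integral_le (κ y)⟩

theorem integral_bind (hf : IsBoundedMeasurable f C) (κ : Kernel Y X) [IsMarkovKernel κ]
    (μ : Measure Y) [IsProbabilityMeasure μ] :
    ∫ x, f x ∂(μ.bind κ) = ∫ y, ∫ x, f x ∂(κ y) ∂μ :=
  Kernel.integral_comp (κ := Kernel.const Unit μ) (a := ()) (hf.integrable _)

theorem integral_compProd {f : Y × X → ℝ} (hf : IsBoundedMeasurable f C) (κ : Kernel Y X)
    [IsMarkovKernel κ] (μ : Measure Y) [IsProbabilityMeasure μ] :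
    ∫ z, f z ∂(μ ⊗ₘ κ) = ∫ y, ∫ x, f (y, x) ∂(κ y) ∂μ :=
  Measure.integral_compProd (hf.integrable _)

theorem integral_id_prod {f : Y × X → ℝ} (hf : IsBoundedMeasurable f C) (κ : Kernel Y X)
    [IsMarkovKernel κ] (y : Y) :
    ∫ z, f z ∂((Kernel.id ×ₖ κ) y) = ∫ x, f (y, x) ∂(κ y) := by
  rw [Kernel.prod_apply, Kernel.id_apply, integral_prod _ (hf.integrable _), integral_dirac']
  exact hf.measurable.stronglyMeasurable.integral_prod_right'

end IsBoundedMeasurable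

section DiscountedSum

variable {X : Type*} [MeasurableSpace X]

instance isMarkovKernel_pow (κ : Kernel X X) [IsMarkovKernel κ] (t : ℕ) :
    IsMarkovKernel (κ ^ t) := by
  induction t with
  | zero => exact inferInstanceAs (IsMarkovKernel (Kernel.id : Kernel X X))
  | succ t ih =>
    rw [Kernel.pow_add, pow_one]
    infer_instance

/-- The expected discounted sum `E[∑ₜ γᵗ g(xₜ) | x₀ = x]` along the Markov chain with kernel `κ`,
that is, the solution `G` of the Bellman equation `G = g + γ κ G`. -/
noncomputable def discountedSum (κ : Kernel X X) (γ : ℝ) (g : X → ℝ) (x : X) : ℝ :=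
  ∑' t : ℕ, γ ^ t * ∫ y, g y ∂((κ ^ t) x)

variable {κ κ' : Kernel X X} [IsMarkovKernel κ] [IsMarkovKernel κ'] {γ C : ℝ} {g : X → ℝ}

theorem isBoundedMeasurable_discountedSum_term (hγ : 0 ≤ γ) (hg : IsBoundedMeasurable g C)
    (t : ℕ) : IsBoundedMeasurable (fun x => γ ^ t * ∫ y, g y ∂((κ ^ t) x)) (γ ^ t * C) := by
  simpa only [abs_of_nonneg (pow_nonneg hγ t)] using (hg.integral_kernel (κ ^ t)).const_mul (γ ^ t)

theorem hasSum_discountedSum (hγ : 0 ≤ γ) (hγ1 : γ < 1) (hg : IsBoundedMeasurable g C) (x : X) :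
    HasSum (fun t : ℕ => γ ^ t * ∫ y, g y ∂((κ ^ t) x)) (discountedSum κ γ g x) :=
  (((summable_geometric_of_lt_one hγ hγ1).mul_right C).of_norm_bounded
    fun t => (isBoundedMeasurable_discountedSum_term (κ := κ) hγ hg t).abs_le x).hasSum

theorem isBoundedMeasurable_discountedSum (hγ : 0 ≤ γ) (hγ1 : γ < 1)
    (hg : IsBoundedMeasurable g C) :
    IsBoundedMeasurable (discountedSum κ γ g) (C / (1 - γ)) where
  measurable := by
    refine measurable_of_tendsto_metrizable (fun n => ?_)
      (tendsto_pi_nhds.2 fun x => (hasSum_discountedSum hγ hγ1 hg x).tendsto_sum_nat)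
    exact Finset.measurable_sum _ fun t _ =>
      (isBoundedMeasurable_discountedSum_term hγ hg t).measurable
  abs_le x := by
    rw [div_eq_inv_mul, ← Real.norm_eq_abs]
    exact tsum_of_norm_bounded ((hasSum_geometric_of_lt_one hγ hγ1).mul_right C)
      fun t => (isBoundedMeasurable_discountedSum_term hγ hg t).abs_le x

theorem hasSum_integral_discountedSum (hγ : 0 ≤ γ) (hγ1 : γ < 1) (hg : IsBoundedMeasurable g C)
    (ν : Measure X) [IsProbabilityMeasure ν] :
    HasSum (fun t : ℕ => γ ^ t * ∫ y, g y ∂(ν.bind (κ ^ t))) (∫ x, discountedSum κ γ g x ∂ν) := by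
  have hterm := isBoundedMeasurable_discountedSum_term (κ := κ) hγ hg
  have hsum : Summable fun t : ℕ => ∫ x, ‖γ ^ t * ∫ y, g y ∂((κ ^ t) x)‖ ∂ν :=
    ((summable_geometric_of_lt_one hγ hγ1).mul_right C).of_norm_bounded fun t =>
      IsBoundedMeasurable.abs_integral_le
        ⟨(hterm t).measurable.norm, fun x => by simpa using (hterm t).abs_le x⟩ ν
  simpa only [discountedSum, integral_const_mul, ← hg.integral_bind] using
    hasSum_integral_of_summable_integral_norm (fun t => (hterm t).integrable ν) hsum

theorem discountedSum_eq (hγ : 0 ≤ γ) (hγ1 : γ < 1) (hg : IsBoundedMeasurable g C) (x : X) :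
    discountedSum κ γ g x = g x + γ * ∫ y, discountedSum κ γ g y ∂(κ x) := by
  have hzero : ∫ y, g y ∂((κ ^ 0) x) = g x :=
    integral_dirac' g x hg.measurable.stronglyMeasurable
  have hsucc : ∀ t : ℕ, γ * (γ ^ t * ∫ y, g y ∂((κ x).bind (κ ^ t)))
      = γ ^ (t + 1) * ∫ y, g y ∂((κ ^ (t + 1)) x) := fun t => by
    rw [← Kernel.comp_apply, Kernel.pow_add, pow_one]
    ring
  have htail := (hasSum_integral_discountedSum (κ := κ) hγ hγ1 hg (κ x)).mul_left γ
  simp only [hsucc] at htail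
  rw [discountedSum, (hasSum_discountedSum hγ hγ1 hg x).summable.tsum_eq_zero_add, htail.tsum_eq,
    pow_zero, one_mul, hzero]

/-- The Bellman operator is a `γ`-contraction, so a function `c`-close to its own image is
`c / (1 - γ)`-close to the fixed point. -/
theorem abs_sub_le_of_bellman_residual (hγ : 0 ≤ γ) (hγ1 : γ < 1) {G G' g' : X → ℝ} {D c : ℝ}
    (hG : IsBoundedMeasurable G C) (hG' : IsBoundedMeasurable G' D)
    (hfix : ∀ x, G' x = g' x + γ * ∫ y, G' y ∂(κ' x))
    (hres : ∀ x, |G x - (g' x + γ * ∫ y, G y ∂(κ' x))| ≤ c) (x : X) :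
    |G x - G' x| ≤ c / (1 - γ) := by
  set b := ⨆ y, |G y - G' y|
  have hb : ∀ y, |G y - G' y| ≤ b :=
    le_ciSup ⟨C + D, Set.forall_mem_range.2 (hG.sub hG').abs_le⟩
  have : Nonempty X := ⟨x⟩
  have hcontract : b ≤ c + γ * b := ciSup_le fun y => by
    calc |G y - G' y|
        = |(G y - (g' y + γ * ∫ z, G z ∂(κ' y)))
            + γ * (∫ z, G z ∂(κ' y) - ∫ z, G' z ∂(κ' y))| := by
          rw [hfix y]
          ring_nf
      _ ≤ c + γ * b := (abs_add_le _ _).trans <| add_le_add (hres y) <| by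
          rw [abs_mul, abs_of_nonneg hγ]
          exact mul_le_mul_of_nonneg_left (hG.abs_integral_sub_le hG' hb _) hγ
  rw [le_div_iff₀ (sub_pos.2 hγ1)]
  nlinarith [hb x]

end DiscountedSum

/-- `f` is `c`-Lipschitz for the cost `d`, which need not be the distance of `X`: state-action pairs
carry the distance `sumDist`, not the maximum distance of `S × A`. -/
def LipschitzFor {X : Type*} (d : X → X → ℝ) (c : ℝ) (f : X → ℝ) : Prop :=
  ∀ x y, |f x - f y| ≤ c * d x y

/-- The distance `d_X + d_Y` on `X × Y`, the one of the paper on state-action pairs. -/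
def sumDist {X Y : Type*} [Dist X] [Dist Y] (x y : X × Y) : ℝ :=
  dist x.1 y.1 + dist x.2 y.2

/-- The Kantorovich distance of `p` and `q` for the cost `d` is at most `ε`, in dual form and tested
against bounded functions only. -/
def KantorovichLE {X : Type*} [MeasurableSpace X] (d : X → X → ℝ) (p q : Measure X) (ε : ℝ) :
    Prop :=
  ∀ ⦃f : X → ℝ⦄ ⦃C c : ℝ⦄, IsBoundedMeasurable f C → 0 ≤ c → LipschitzFor d c f →
    |∫ x, f x ∂p - ∫ x, f x ∂q| ≤ c * ε

/-- The kernel `κ` is `k`-Lipschitz from the cost `d` to the Kantorovich distance for `d'`. -/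
def LipschitzKernel {X Y : Type*} [MeasurableSpace X] [MeasurableSpace Y] (d : X → X → ℝ)
    (d' : Y → Y → ℝ) (k : ℝ) (κ : Kernel X Y) : Prop :=
  ∀ x y, KantorovichLE d' (κ x) (κ y) (k * d x y)

section LipschitzFor

variable {X : Type*} {d : X → X → ℝ} {f g : X → ℝ} {a b c C D : ℝ}

theorem LipschitzFor.mul (hf : LipschitzFor d a f) (hg : LipschitzFor d b g)
    (hfC : ∀ x, |f x| ≤ C) (hgD : ∀ x, |g x| ≤ D) :
    LipschitzFor d (D * a + C * b) (fun x => f x * g x) := fun x y => by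
  calc |f x * g x - f y * g y|
      = |g x * (f x - f y) + f y * (g x - g y)| := by ring_nf
    _ ≤ |g x| * |f x - f y| + |f y| * |g x - g y| := by
        rw [← abs_mul, ← abs_mul]
        exact abs_add_le _ _
    _ ≤ D * (a * d x y) + C * (b * d x y) :=
        add_le_add
          (mul_le_mul (hgD x) (hf x y) (abs_nonneg _) ((abs_nonneg _).trans (hgD x)))
          (mul_le_mul (hfC y) (hg x y) (abs_nonneg _) ((abs_nonneg _).trans (hfC y)))
    _ = (D * a + C * b) * d x y := by ring

theorem LipschitzFor.eq_of_zero (hf : LipschitzFor d 0 f) (x y : X) : f x = f y := by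
  simpa [sub_eq_zero] using hf x y

theorem LipschitzFor.lipschitzWith_inv_mul [PseudoMetricSpace X] (hf : LipschitzFor dist c f)
    (hc : 0 < c) : LipschitzWith 1 fun x => c⁻¹ * f x :=
  LipschitzWith.of_dist_le_mul fun x y => by
    rw [Real.dist_eq, ← mul_sub, abs_mul, abs_of_pos (inv_pos.2 hc), NNReal.coe_one, one_mul,
      inv_mul_le_iff₀ hc]
    exact hf x y

end LipschitzFor

section KantorovichLE

variable {X Y : Type*} [MeasurableSpace X] [MeasurableSpace Y] {d : X → X → ℝ} {d' : Y → Y → ℝ}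

theorem enorm_integral_sub_le_kantorovich {X : Type*} [MetricSpace X] [MeasurableSpace X]
    {p q : Measure X} {f : X → ℝ} (hf : LipschitzWith 1 f) (hp : Integrable f p)
    (hq : Integrable f q) : ‖∫ x, f x ∂p - ∫ x, f x ∂q‖ₑ ≤ kantorovich p q :=
  le_iSup₂_of_le f hf (le_iSup₂_of_le hp hq le_rfl)

theorem KantorovichLE.of_kantorovich_le {X : Type*} [MetricSpace X] [MeasurableSpace X]
    {p q : Measure X} [IsProbabilityMeasure p] [IsProbabilityMeasure q] {ε : ℝ} (hε : 0 ≤ ε)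
    (h : kantorovich p q ≤ ENNReal.ofReal ε) : KantorovichLE dist p q ε := by
  intro f C c hf hc hlip
  rcases hc.eq_or_lt with rfl | hpos
  · obtain ⟨x₀⟩ : Nonempty X := Measure.nonempty_of_neZero p
    simp [fun x => hlip.eq_of_zero x x₀]
  · have hint := (hf.const_mul c⁻¹).integrable
    have hle := (enorm_integral_sub_le_kantorovich (hlip.lipschitzWith_inv_mul hpos)
      (hint p) (hint q)).trans h
    rwa [Real.enorm_eq_ofReal_abs, ENNReal.ofReal_le_ofReal_iff hε, integral_const_mul,
      integral_const_mul, ← mul_sub, abs_mul, abs_of_pos (inv_pos.2 hpos),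
      inv_mul_le_iff₀ hpos] at hle

theorem LipschitzKernel.lipschitzFor_integral {k c C : ℝ} {κ : Kernel X Y} {f : Y → ℝ}
    (hκ : LipschitzKernel d d' k κ) (hf : IsBoundedMeasurable f C) (hc : 0 ≤ c)
    (hlip : LipschitzFor d' c f) : LipschitzFor d (c * k) fun x => ∫ y, f y ∂(κ x) := fun x y => by
  rw [mul_assoc]
  exact hκ x y hf hc hlip

theorem KantorovichLE.bind {p q : Measure X} [IsProbabilityMeasure p] [IsProbabilityMeasure q]
    {κ : Kernel X Y} [IsMarkovKernel κ] {k ε : ℝ} (h : KantorovichLE d p q ε)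
    (hκ : LipschitzKernel d d' k κ) (hk : 0 ≤ k) :
    KantorovichLE d' (p.bind κ) (q.bind κ) (k * ε) := by
  intro f C c hf hc hlip
  rw [hf.integral_bind, hf.integral_bind, ← mul_assoc]
  exact h (hf.integral_kernel κ) (mul_nonneg hc hk) (hκ.lipschitzFor_integral hf hc hlip)

theorem KantorovichLE.bind_of_forall {p : Measure X} [IsProbabilityMeasure p]
    {κ κ' : Kernel X Y} [IsMarkovKernel κ] [IsMarkovKernel κ'] {ε : ℝ}
    (h : ∀ x, KantorovichLE d' (κ x) (κ' x) ε) :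
    KantorovichLE d' (p.bind κ) (p.bind κ') ε := by
  intro f C c hf hc hlip
  rw [hf.integral_bind, hf.integral_bind]
  exact (hf.integral_kernel κ).abs_integral_sub_le (hf.integral_kernel κ')
    (fun x => h x hf hc hlip) p

theorem LipschitzKernel.comp {Z : Type*} [MeasurableSpace Z] {d'' : Z → Z → ℝ} {k k' : ℝ}
    {η : Kernel Y Z} {κ : Kernel X Y} [IsMarkovKernel η] [IsMarkovKernel κ]
    (hη : LipschitzKernel d' d'' k' η) (hκ : LipschitzKernel d d' k κ) (hk' : 0 ≤ k') :
    LipschitzKernel d d'' (k' * k) (η ∘ₖ κ) := fun x y => by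
  rw [Kernel.comp_apply, Kernel.comp_apply, mul_assoc]
  exact (hκ x y).bind hη hk'

theorem lipschitzKernel_id : LipschitzKernel d d 1 Kernel.id := by
  intro x y f C c hf _ hlip
  have hdirac : ∀ z, ∫ w, f w ∂(Kernel.id z) = f z := fun z =>
    integral_dirac' f z hf.measurable.stronglyMeasurable
  rw [hdirac, hdirac, one_mul]
  exact hlip x y

theorem LipschitzKernel.pow {k : ℝ} {κ : Kernel X X} [IsMarkovKernel κ]
    (hκ : LipschitzKernel d d k κ) (hk : 0 ≤ k) (t : ℕ) :
    LipschitzKernel d d (k ^ t) (κ ^ t) := by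
  induction t with
  | zero => exact lipschitzKernel_id
  | succ t ih =>
    rw [pow_succ, Kernel.pow_add, pow_one]
    exact ih.comp hκ (pow_nonneg hk t)

theorem LipschitzKernel.id_prod {X Y : Type*} [PseudoMetricSpace X] [MeasurableSpace X]
    [PseudoMetricSpace Y] [MeasurableSpace Y] {L : ℝ} {κ : Kernel X Y} [IsMarkovKernel κ]
    (hκ : LipschitzKernel dist dist L κ) :
    LipschitzKernel dist sumDist (1 + L) (Kernel.id ×ₖ κ) := by
  intro x x' f C c hf hc hlip
  have hf' : ∀ z, IsBoundedMeasurable (fun y => f (z, y)) C := fun z =>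
    hf.comp measurable_prodMk_left
  have hfst : ∀ y, |f (x, y) - f (x', y)| ≤ c * dist x x' := fun y => by
    simpa [sumDist] using hlip (x, y) (x', y)
  have hsnd : LipschitzFor dist c fun y => f (x', y) := fun y y' => by
    simpa [sumDist] using hlip (x', y) (x', y')
  rw [hf.integral_id_prod, hf.integral_id_prod]
  calc |∫ y, f (x, y) ∂(κ x) - ∫ y, f (x', y) ∂(κ x')|
      ≤ |∫ y, f (x, y) ∂(κ x) - ∫ y, f (x', y) ∂(κ x)|
        + |∫ y, f (x', y) ∂(κ x) - ∫ y, f (x', y) ∂(κ x')| := abs_sub_le _ _ _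
    _ ≤ c * dist x x' + c * (L * dist x x') :=
        add_le_add ((hf' x).abs_integral_sub_le (hf' x') hfst _) (hκ x x' (hf' x') hc hsnd)
    _ = c * ((1 + L) * dist x x') := by ring

end KantorovichLE

section DiscountedSum

variable {X : Type*} [MeasurableSpace X] {d : X → X → ℝ} {κ κ' : Kernel X X} [IsMarkovKernel κ]
  [IsMarkovKernel κ'] {γ k ℓ C D ε εg : ℝ} {g g' : X → ℝ}

theorem LipschitzKernel.lipschitzFor_discountedSum (hκ : LipschitzKernel d d k κ) (hk : 0 ≤ k)
    (hγ : 0 ≤ γ) (hγ1 : γ < 1) (hγk : γ * k < 1) (hg : IsBoundedMeasurable g C) (hℓ : 0 ≤ ℓ)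
    (hlip : LipschitzFor d ℓ g) : LipschitzFor d (ℓ / (1 - γ * k)) (discountedSum κ γ g) := by
  intro x y
  have hterm : ∀ t : ℕ, ‖γ ^ t * ∫ z, g z ∂((κ ^ t) x) - γ ^ t * ∫ z, g z ∂((κ ^ t) y)‖
      ≤ (γ * k) ^ t * (ℓ * d x y) := fun t => by
    rw [← mul_sub, norm_mul, Real.norm_of_nonneg (pow_nonneg hγ t)]
    calc γ ^ t * |∫ z, g z ∂((κ ^ t) x) - ∫ z, g z ∂((κ ^ t) y)|
        ≤ γ ^ t * (ℓ * k ^ t * d x y) :=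
          mul_le_mul_of_nonneg_left ((hκ.pow hk t).lipschitzFor_integral hg hℓ hlip x y)
            (pow_nonneg hγ t)
      _ = (γ * k) ^ t * (ℓ * d x y) := by ring
  have hsum := (hasSum_discountedSum (κ := κ) hγ hγ1 hg x).sub
    (hasSum_discountedSum (κ := κ) hγ hγ1 hg y)
  calc |discountedSum κ γ g x - discountedSum κ γ g y|
      ≤ (1 - γ * k)⁻¹ * (ℓ * d x y) := by
        rw [← hsum.tsum_eq]
        exact tsum_of_norm_bounded
          ((hasSum_geometric_of_lt_one (mul_nonneg hγ hk) hγk).mul_right _) hterm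
    _ = ℓ / (1 - γ * k) * d x y := by ring

theorem abs_discountedSum_sub_le (hγ : 0 ≤ γ) (hγ1 : γ < 1) (hg : IsBoundedMeasurable g C)
    (hg' : IsBoundedMeasurable g' D) (hlip : LipschitzFor d ℓ (discountedSum κ γ g)) (hℓ : 0 ≤ ℓ)
    (hgg' : ∀ x, |g x - g' x| ≤ εg) (hκκ' : ∀ x, KantorovichLE d (κ x) (κ' x) ε) (x : X) :
    |discountedSum κ γ g x - discountedSum κ' γ g' x| ≤ (εg + γ * (ℓ * ε)) / (1 - γ) := by
  have hG := isBoundedMeasurable_discountedSum (κ := κ) hγ hγ1 hg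
  refine abs_sub_le_of_bellman_residual hγ hγ1 hG (isBoundedMeasurable_discountedSum hγ hγ1 hg')
    (discountedSum_eq hγ hγ1 hg') (fun y => ?_) x
  calc |discountedSum κ γ g y - (g' y + γ * ∫ z, discountedSum κ γ g z ∂(κ' y))|
      = |(g y - g' y) + γ * (∫ z, discountedSum κ γ g z ∂(κ y)
          - ∫ z, discountedSum κ γ g z ∂(κ' y))| := by
        rw [discountedSum_eq hγ hγ1 hg y]
        ring_nf
    _ ≤ εg + γ * (ℓ * ε) := (abs_add_le _ _).trans <| add_le_add (hgg' y) <| by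
        rw [abs_mul, abs_of_nonneg hγ]
        exact mul_le_mul_of_nonneg_left (hκκ' y hG hℓ hlip) hγ

end DiscountedSum

theorem lipQ_nonneg {γ LP Lr Lπ : ℝ} (hLr : 0 ≤ Lr) (h : γ * LP * (1 + Lπ) < 1) :
    0 ≤ lipQ γ LP Lr Lπ :=
  div_nonneg hLr (sub_pos.2 h).le

namespace CMDP

section Values

variable {Ω S A : Type*} [MeasurableSpace S] [MeasurableSpace A] {m : ℕ}
  (M : CMDP Ω S A) (π : ParametricPolicy m S A) (ω : Ω) (θ : EuclideanSpace ℝ (Fin m))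

instance isMarkovKernel_P : IsMarkovKernel (M.P ω) := M.markov_P ω

instance isProbabilityMeasure_μ : IsProbabilityMeasure M.μ := M.prob_μ

theorem one_sub_γ_pos : 0 < 1 - M.γ := sub_pos.2 M.γ_lt_one

theorem isBoundedMeasurable_R : IsBoundedMeasurable (M.R ω) M.Rmax :=
  ⟨M.measurable_R ω, M.abs_R_le ω⟩

theorem nStepSA_eq_pow (t : ℕ) : M.nStepSA π ω θ t = M.stepSA π ω θ ^ t := by
  induction t with
  | zero => rfl
  | succ t ih => rw [nStepSA, ih, add_comm, Kernel.pow_add, pow_one]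

theorem Q_eq_discountedSum (s : S) (a : A) :
    M.Q π ω θ s a = discountedSum (M.stepSA π ω θ) M.γ (M.R ω) (s, a) := by
  simp only [Q, discountedSum, nStepSA_eq_pow]

variable [IsMarkovKernel (π.kernel θ)]

instance isMarkovKernel_stepSA : IsMarkovKernel (M.stepSA π ω θ) :=
  inferInstanceAs (IsMarkovKernel ((Kernel.id ×ₖ π.kernel θ) ∘ₖ M.P ω))

instance isMarkovKernel_stepS : IsMarkovKernel (M.stepS π ω θ) :=
  inferInstanceAs (IsMarkovKernel (M.P ω ∘ₖ (Kernel.id ×ₖ π.kernel θ)))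

theorem stepSA_apply (x : S × A) : M.stepSA π ω θ x = M.P ω x ⊗ₘ π.kernel θ := by
  rw [stepSA, Kernel.comp_apply, Measure.compProd_eq_comp_prod]

theorem integral_stepS {f : S → ℝ} {C : ℝ} (hf : IsBoundedMeasurable f C) (s : S) :
    ∫ y, f y ∂(M.stepS π ω θ s) = ∫ a, ∫ y, f y ∂(M.P ω (s, a)) ∂(π.kernel θ s) := by
  rw [stepS, Kernel.comp_apply, hf.integral_bind, (hf.integral_kernel (M.P ω)).integral_id_prod]

theorem isBoundedMeasurable_Q :
    IsBoundedMeasurable (fun x : S × A => M.Q π ω θ x.1 x.2) (M.Rmax / (1 - M.γ)) := by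
  simpa only [Q_eq_discountedSum] using
    isBoundedMeasurable_discountedSum M.γ_nonneg M.γ_lt_one (M.isBoundedMeasurable_R ω)

theorem isBoundedMeasurable_V : IsBoundedMeasurable (M.V π ω θ) (M.Rmax / (1 - M.γ)) :=
  (M.isBoundedMeasurable_Q π ω θ).integral_kernel_prod (π.kernel θ)

theorem integral_stepSA_Q (x : S × A) :
    ∫ y, M.Q π ω θ y.1 y.2 ∂(M.stepSA π ω θ x) = ∫ s, M.V π ω θ s ∂(M.P ω x) := by
  rw [stepSA_apply, (M.isBoundedMeasurable_Q π ω θ).integral_compProd]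
  rfl

theorem Q_bellman (x : S × A) :
    M.Q π ω θ x.1 x.2 = M.R ω x + M.γ * ∫ y, M.Q π ω θ y.1 y.2 ∂(M.stepSA π ω θ x) := by
  simpa only [Q_eq_discountedSum] using
    discountedSum_eq M.γ_nonneg M.γ_lt_one (M.isBoundedMeasurable_R ω) x

theorem Q_eq_add_integral_V (s : S) (a : A) :
    M.Q π ω θ s a = M.R ω (s, a) + M.γ * ∫ s', M.V π ω θ s' ∂(M.P ω (s, a)) := by
  rw [← integral_stepSA_Q]
  exact M.Q_bellman π ω θ (s, a)

instance isProbabilityMeasure_stateLaw (t : ℕ) : IsProbabilityMeasure (M.stateLaw π ω θ t) := by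
  induction t with
  | zero => exact M.prob_μ
  | succ t ih => exact inferInstanceAs (IsProbabilityMeasure (M.stepS π ω θ ∘ₘ M.stateLaw π ω θ t))

instance isProbabilityMeasure_occupancy : IsProbabilityMeasure (M.occupancy π ω θ) := by
  constructor
  have hγ := M.one_sub_γ_pos
  simp only [occupancy, Measure.smul_apply, Measure.sum_apply _ MeasurableSet.univ, measure_univ,
    smul_eq_mul, mul_one]
  rw [← ENNReal.ofReal_tsum_of_nonneg (fun t => pow_nonneg M.γ_nonneg t)
      (summable_geometric_of_lt_one M.γ_nonneg M.γ_lt_one),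
    tsum_geometric_of_lt_one M.γ_nonneg M.γ_lt_one, ← ENNReal.ofReal_mul hγ.le,
    mul_inv_cancel₀ hγ.ne', ENNReal.ofReal_one]

theorem hasSum_integral_occupancy {f : S → ℝ} {C : ℝ} (hf : IsBoundedMeasurable f C) :
    HasSum (fun t : ℕ => (1 - M.γ) * (M.γ ^ t * ∫ s, f s ∂(M.stateLaw π ω θ t)))
      (∫ s, f s ∂(M.occupancy π ω θ)) := by
  have hγ := M.one_sub_γ_pos
  have hint : Integrable f
      (Measure.sum fun t : ℕ => ENNReal.ofReal (M.γ ^ t) • M.stateLaw π ω θ t) := by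
    have h := hf.integrable (M.occupancy π ω θ)
    rwa [occupancy, integrable_smul_measure (by simpa using hγ) ENNReal.ofReal_ne_top] at h
  have h := (hasSum_integral_measure hint).mul_left (1 - M.γ)
  rw [occupancy, integral_smul_measure, ENNReal.toReal_ofReal hγ.le, smul_eq_mul]
  simpa only [integral_smul_measure, ENNReal.toReal_ofReal (pow_nonneg M.γ_nonneg _),
    smul_eq_mul] using h

theorem integral_occupancy_sub {f : S → ℝ} {C : ℝ} (hf : IsBoundedMeasurable f C) :
    ∫ s, (f s - M.γ * ∫ y, f y ∂(M.stepS π ω θ s)) ∂(M.occupancy π ω θ)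
      = (1 - M.γ) * ∫ s, f s ∂M.μ := by
  have hstep := (hf.integral_kernel (M.stepS π ω θ)).const_mul M.γ
  have hshift : ∀ t : ℕ, (1 - M.γ) * (M.γ ^ t *
      ∫ s, M.γ * ∫ y, f y ∂(M.stepS π ω θ s) ∂(M.stateLaw π ω θ t))
      = (1 - M.γ) * (M.γ ^ (t + 1) * ∫ s, f s ∂(M.stateLaw π ω θ (t + 1))) := fun t => by
    rw [integral_const_mul, stateLaw, hf.integral_bind]
    ring
  have hsum := M.hasSum_integral_occupancy π ω θ hf
  have hsum' := M.hasSum_integral_occupancy π ω θ hstep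
  simp only [hshift] at hsum'
  rw [integral_sub (hf.integrable _) (hstep.integrable _), ← hsum.tsum_eq, ← hsum'.tsum_eq,
    hsum.summable.tsum_eq_zero_add, add_sub_cancel_right, pow_zero, one_mul, stateLaw]

theorem policyGradient_eq_integral_compProd {i : Fin m} {B : ℝ}
    (hscore : IsBoundedMeasurable (fun x : S × A => π.score i θ x.1 x.2) B) :
    M.policyGradient π i ω θ
      = ∫ x, M.eta π i ω θ x.1 x.2 ∂(M.occupancy π ω θ ⊗ₘ π.kernel θ) :=
  ((hscore.mul (M.isBoundedMeasurable_Q π ω θ)).integral_compProd _ _).symm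

theorem kantorovichLE_stepS {ω ω' : Ω} {d : S → S → ℝ} {ε : ℝ}
    (hPP' : ∀ x, KantorovichLE d (M.P ω x) (M.P ω' x) ε) (s : S) :
    KantorovichLE d (M.stepS π ω θ s) (M.stepS π ω' θ s) ε := by
  rw [stepS, stepS, Kernel.comp_apply, Kernel.comp_apply]
  exact .bind_of_forall hPP'

end Values

section ContextLipschitz

variable {Ω S A : Type*} [PseudoMetricSpace S] [MeasurableSpace S] [PseudoMetricSpace A]
  [MeasurableSpace A] {m : ℕ} {M : CMDP Ω S A} {π : ParametricPolicy m S A} {ω ω' : Ω}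
  {θ : EuclideanSpace ℝ (Fin m)} [IsMarkovKernel (π.kernel θ)] {LP Lr Lπ Lscore : ℝ≥0}
  {B εP εr : ℝ} {i : Fin m}

theorem lipschitzKernel_stepS (hP : LipschitzKernel sumDist dist LP (M.P ω))
    (hπ : LipschitzKernel dist dist Lπ (π.kernel θ)) :
    LipschitzKernel dist dist (LP * (1 + Lπ)) (M.stepS π ω θ) :=
  hP.comp hπ.id_prod LP.coe_nonneg

theorem lipschitzKernel_stepSA (hP : LipschitzKernel sumDist dist LP (M.P ω))
    (hπ : LipschitzKernel dist dist Lπ (π.kernel θ)) :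
    LipschitzKernel sumDist sumDist (LP * (1 + Lπ)) (M.stepSA π ω θ) := by
  rw [mul_comm]
  exact hπ.id_prod.comp hP (by positivity)

theorem kantorovichLE_stepSA (hπ : LipschitzKernel dist dist Lπ (π.kernel θ))
    (hPP' : ∀ x, KantorovichLE dist (M.P ω x) (M.P ω' x) εP) (x : S × A) :
    KantorovichLE sumDist (M.stepSA π ω θ x) (M.stepSA π ω' θ x) ((1 + Lπ) * εP) := by
  rw [stepSA, stepSA, Kernel.comp_apply, Kernel.comp_apply]
  exact (hPP' x).bind hπ.id_prod (by positivity)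

theorem lipschitzFor_Q (hP : LipschitzKernel sumDist dist LP (M.P ω))
    (hR : LipschitzFor sumDist Lr (M.R ω)) (hπ : LipschitzKernel dist dist Lπ (π.kernel θ))
    (hω : M.γ * LP * (1 + Lπ) < 1) :
    LipschitzFor sumDist (lipQ M.γ LP Lr Lπ) fun x => M.Q π ω θ x.1 x.2 := by
  rw [mul_assoc] at hω
  simp only [Q_eq_discountedSum, lipQ, mul_assoc]
  exact (lipschitzKernel_stepSA hP hπ).lipschitzFor_discountedSum (by positivity) M.γ_nonneg
    M.γ_lt_one hω (M.isBoundedMeasurable_R ω) Lr.coe_nonneg hR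

theorem abs_Q_sub_le (hP : LipschitzKernel sumDist dist LP (M.P ω))
    (hR : LipschitzFor sumDist Lr (M.R ω)) (hπ : LipschitzKernel dist dist Lπ (π.kernel θ))
    (hω : M.γ * LP * (1 + Lπ) < 1) (hPP' : ∀ x, KantorovichLE dist (M.P ω x) (M.P ω' x) εP)
    (hRR' : ∀ x, |M.R ω x - M.R ω' x| ≤ εr) (s : S) (a : A) :
    |M.Q π ω θ s a - M.Q π ω' θ s a| ≤ lipCtxQ M.γ LP Lr Lπ εP εr := by
  have hlip := lipschitzFor_Q hP hR hπ hω
  simp only [Q_eq_discountedSum] at hlip ⊢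
  refine (abs_discountedSum_sub_le M.γ_nonneg M.γ_lt_one (M.isBoundedMeasurable_R ω)
    (M.isBoundedMeasurable_R ω') hlip
    (lipQ_nonneg Lr.coe_nonneg hω) hRR' (kantorovichLE_stepSA hπ hPP') (s, a)).trans_eq ?_
  rw [lipCtxQ, lipV]
  ring

/-- Apply `integral_occupancy_sub` in both contexts to the solution `G` of `G = f + γ T_ω G`: the
terms `(1 - γ) ∫ G dμ` cancel and `γ ∫ (T_ω' G - T_ω G)` remains. -/
theorem kantorovichLE_occupancy (hP : LipschitzKernel sumDist dist LP (M.P ω))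
    (hπ : LipschitzKernel dist dist Lπ (π.kernel θ)) (hω : M.γ * LP * (1 + Lπ) < 1)
    (hPP' : ∀ x, KantorovichLE dist (M.P ω x) (M.P ω' x) εP) :
    KantorovichLE dist (M.occupancy π ω θ) (M.occupancy π ω' θ) (lipDelta M.γ LP Lπ εP) := by
  intro f C c hf hc hlip
  set G := discountedSum (M.stepS π ω θ) M.γ f
  have hG : IsBoundedMeasurable G _ := isBoundedMeasurable_discountedSum M.γ_nonneg M.γ_lt_one hf
  have hGf : ∀ s, f s = G s - M.γ * ∫ y, G y ∂(M.stepS π ω θ s) := fun s =>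
    eq_sub_of_add_eq (discountedSum_eq M.γ_nonneg M.γ_lt_one hf s).symm
  have hGlip : LipschitzFor dist (c / (1 - M.γ * (LP * (1 + Lπ)))) G :=
    (lipschitzKernel_stepS hP hπ).lipschitzFor_discountedSum (by positivity) M.γ_nonneg
      M.γ_lt_one (by rwa [← mul_assoc]) hf hc hlip
  have hstep : IsBoundedMeasurable
      (fun s => G s - M.γ * ∫ y, G y ∂(M.stepS π ω' θ s)) _ :=
    hG.sub ((hG.integral_kernel (M.stepS π ω' θ)).const_mul M.γ)
  have hclose : ∀ s, |(G s - M.γ * ∫ y, G y ∂(M.stepS π ω' θ s)) - f s|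
      ≤ M.γ * (c / (1 - M.γ * (LP * (1 + Lπ))) * εP) := fun s => by
    rw [hGf s, sub_sub_sub_cancel_left, ← mul_sub, abs_mul, abs_of_nonneg M.γ_nonneg]
    exact mul_le_mul_of_nonneg_left (M.kantorovichLE_stepS π θ hPP' s hG
      (div_nonneg hc (by rw [← mul_assoc]; exact (sub_pos.2 hω).le)) hGlip) M.γ_nonneg
  calc |∫ s, f s ∂(M.occupancy π ω θ) - ∫ s, f s ∂(M.occupancy π ω' θ)|
      = |∫ s, (G s - M.γ * ∫ y, G y ∂(M.stepS π ω' θ s)) ∂(M.occupancy π ω' θ)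
          - ∫ s, f s ∂(M.occupancy π ω' θ)| := by
        rw [M.integral_occupancy_sub π ω' θ hG, ← M.integral_occupancy_sub π ω θ hG]
        simp only [← hGf]
    _ ≤ M.γ * (c / (1 - M.γ * (LP * (1 + Lπ))) * εP) := hstep.abs_integral_sub_le hf hclose _
    _ = c * lipDelta M.γ LP Lπ εP := by
        rw [lipDelta]
        ring

theorem lipschitzFor_eta (hP : LipschitzKernel sumDist dist LP (M.P ω))
    (hR : LipschitzFor sumDist Lr (M.R ω)) (hπ : LipschitzKernel dist dist Lπ (π.kernel θ))
    (hω : M.γ * LP * (1 + Lπ) < 1) (hB : ∀ s a, |π.score i θ s a| ≤ B)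
    (hscore : LipschitzFor sumDist Lscore fun x : S × A => π.score i θ x.1 x.2) :
    LipschitzFor sumDist (lipEta M.γ M.Rmax LP Lr Lπ B Lscore)
      fun x : S × A => M.eta π i ω θ x.1 x.2 :=
  hscore.mul (lipschitzFor_Q hP hR hπ hω) (fun x => hB x.1 x.2)
    (M.isBoundedMeasurable_Q π ω θ).abs_le

theorem abs_policyGradient_sub_le (hP : LipschitzKernel sumDist dist LP (M.P ω))
    (hR : LipschitzFor sumDist Lr (M.R ω)) (hπ : LipschitzKernel dist dist Lπ (π.kernel θ))
    (hω : M.γ * LP * (1 + Lπ) < 1) (hPP' : ∀ x, KantorovichLE dist (M.P ω x) (M.P ω' x) εP)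
    (hRR' : ∀ x, |M.R ω x - M.R ω' x| ≤ εr)
    (hB : IsBoundedMeasurable (fun x : S × A => π.score i θ x.1 x.2) B)
    (hscore : LipschitzFor sumDist Lscore fun x : S × A => π.score i θ x.1 x.2) :
    |M.policyGradient π i ω θ - M.policyGradient π i ω' θ|
      ≤ lipGrad M.γ M.Rmax LP Lr Lπ εP εr B Lscore := by
  obtain ⟨s₀⟩ : Nonempty S := Measure.nonempty_of_neZero M.μ
  obtain ⟨a₀⟩ : Nonempty A := Measure.nonempty_of_neZero (π.kernel θ s₀)
  have hB0 : 0 ≤ B := (abs_nonneg _).trans (hB.abs_le (s₀, a₀))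
  have hQ0 : 0 ≤ M.Rmax / (1 - M.γ) :=
    (abs_nonneg _).trans ((M.isBoundedMeasurable_Q π ω θ).abs_le (s₀, a₀))
  have hη0 : 0 ≤ lipEta M.γ M.Rmax LP Lr Lπ B Lscore :=
    add_nonneg (mul_nonneg hQ0 Lscore.coe_nonneg)
      (mul_nonneg hB0 (lipQ_nonneg Lr.coe_nonneg hω))
  have hη : ∀ ω, IsBoundedMeasurable (fun x : S × A => M.eta π i ω θ x.1 x.2) _ := fun ω =>
    hB.mul (M.isBoundedMeasurable_Q π ω θ)
  set ρ := M.occupancy π ω θ ⊗ₘ π.kernel θ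
  set ρ' := M.occupancy π ω' θ ⊗ₘ π.kernel θ
  have hρ : KantorovichLE sumDist ρ ρ' ((1 + Lπ) * lipDelta M.γ LP Lπ εP) := by
    simp only [ρ, ρ', Measure.compProd_eq_comp_prod]
    exact (kantorovichLE_occupancy hP hπ hω hPP').bind hπ.id_prod (by positivity)
  have hclose : ∀ x : S × A, |M.eta π i ω θ x.1 x.2 - M.eta π i ω' θ x.1 x.2|
      ≤ B * lipCtxQ M.γ LP Lr Lπ εP εr := fun x => by
    rw [eta, eta, ← mul_sub, abs_mul]
    exact mul_le_mul (hB.abs_le x) (abs_Q_sub_le hP hR hπ hω hPP' hRR' x.1 x.2) (abs_nonneg _) hB0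
  rw [M.policyGradient_eq_integral_compProd π ω θ hB,
    M.policyGradient_eq_integral_compProd π ω' θ hB]
  calc |∫ x, M.eta π i ω θ x.1 x.2 ∂ρ - ∫ x, M.eta π i ω' θ x.1 x.2 ∂ρ'|
      ≤ |∫ x, M.eta π i ω θ x.1 x.2 ∂ρ - ∫ x, M.eta π i ω θ x.1 x.2 ∂ρ'|
        + |∫ x, M.eta π i ω θ x.1 x.2 ∂ρ' - ∫ x, M.eta π i ω' θ x.1 x.2 ∂ρ'| := abs_sub_le _ _ _
    _ ≤ lipEta M.γ M.Rmax LP Lr Lπ B Lscore * ((1 + Lπ) * lipDelta M.γ LP Lπ εP)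
        + B * lipCtxQ M.γ LP Lr Lπ εP εr :=
        add_le_add
          (hρ (hη ω) hη0 (lipschitzFor_eta hP hR hπ hω (fun s a => hB.abs_le (s, a)) hscore))
          ((hη ω).abs_integral_sub_le (hη ω') hclose ρ')
    _ = lipGrad M.γ M.Rmax LP Lr Lπ εP εr B Lscore := by rw [lipGrad, ← mul_assoc]

end ContextLipschitz

end CMDP

section LineDeriv

variable {E : Type*} [NormedAddCommGroup E] [NormedSpace ℝ E] {f : E → ℝ} {x v : E}

theorem hasDerivAt_add_smul_of_hasLineDerivAt {f' t : ℝ}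
    (hf : HasLineDerivAt ℝ f f' (x + t • v) v) : HasDerivAt (fun u : ℝ => f (x + u • v)) f' t := by
  have hzero : HasDerivAt (fun u : ℝ => f (x + t • v + u • v)) f' (t - t) := by
    rw [sub_self]
    exact hf
  have hshift := hzero.comp_sub_const t t
  simpa only [add_assoc, ← add_smul, add_sub_cancel] using hshift

theorem abs_sub_le_of_abs_lineDeriv_le {s : Set ℝ} {C h : ℝ} (hs : Convex ℝ s) (h0 : 0 ∈ s)
    (hh : h ∈ s) (hdiff : ∀ t ∈ s, LineDifferentiableAt ℝ f (x + t • v) v)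
    (hC : ∀ t ∈ s, |lineDeriv ℝ f (x + t • v) v| ≤ C) : |f (x + h • v) - f x| ≤ C * |h| := by
  simpa using hs.norm_image_sub_le_of_norm_hasDerivWithin_le
    (fun t ht => (hasDerivAt_add_smul_of_hasLineDerivAt
      (hdiff t ht).hasLineDerivAt).hasDerivWithinAt) hC h0 hh

theorem tendsto_add_smul_nhds (x v : E) : Tendsto (fun h : ℝ => x + h • v) (𝓝 0) (𝓝 x) :=
  Continuous.tendsto' (by fun_prop) _ _ (by simp)

end LineDeriv

namespace ParametricPolicy

variable {m : ℕ} {S A : Type*} [MeasurableSpace S] [MeasurableSpace A]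
  {π : ParametricPolicy m S A} {θ θ' : EuclideanSpace ℝ (Fin m)} {i : Fin m}

theorem kernel_apply (hθ : θ ∈ π.Θ) (s : S) :
    π.kernel θ s = π.ref.withDensity fun a => ENNReal.ofReal (π.density θ s a) := by
  have := π.sigmaFinite_ref
  rw [kernel, Kernel.withDensity_apply _ (π.measurable_density θ hθ).ennreal_ofReal,
    Kernel.const_apply]

theorem isMarkovKernel_kernel (hθ : θ ∈ π.Θ) : IsMarkovKernel (π.kernel θ) := by
  refine ⟨fun s => ⟨?_⟩⟩
  rw [kernel_apply hθ, withDensity_apply _ MeasurableSet.univ, setLIntegral_univ]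
  exact π.lintegral_density θ hθ s

theorem eventually_add_smul_mem_Θ (hθ : θ ∈ π.Θ) (v : EuclideanSpace ℝ (Fin m)) :
    ∀ᶠ h : ℝ in 𝓝 0, θ + h • v ∈ π.Θ :=
  (tendsto_add_smul_nhds θ v).eventually_mem (π.isOpen_Θ.mem_nhds hθ)

/-- The likelihood ratio `π_θ'(a | s) / π_θ(a | s)`, the importance weight that turns expectations
under `π_θ` into expectations under `π_θ'`. -/
noncomputable def likelihoodRatio (π : ParametricPolicy m S A) (θ θ' : EuclideanSpace ℝ (Fin m))
    (s : S) (a : A) : ℝ :=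
  π.density θ' s a / π.density θ s a

theorem likelihoodRatio_eq_exp (hθ : θ ∈ π.Θ) (hθ' : θ' ∈ π.Θ) (s : S) (a : A) :
    π.likelihoodRatio θ θ' s a = Real.exp (π.logDensity s a θ' - π.logDensity s a θ) := by
  rw [likelihoodRatio, Real.exp_sub, logDensity, logDensity, Real.exp_log (π.density_pos θ hθ s a),
    Real.exp_log (π.density_pos θ' hθ' s a)]

theorem measurable_likelihoodRatio (hθ : θ ∈ π.Θ) (hθ' : θ' ∈ π.Θ) :
    Measurable fun x : S × A => π.likelihoodRatio θ θ' x.1 x.2 :=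
  (π.measurable_density θ' hθ').div (π.measurable_density θ hθ)

theorem isBoundedMeasurable_likelihoodRatio_sub_one (hθ : θ ∈ π.Θ) (hθ' : θ' ∈ π.Θ)
    {ε : ℝ}
    (hε : ∀ s a, |π.likelihoodRatio θ θ' s a - 1| ≤ ε) :
    IsBoundedMeasurable (fun x : S × A => π.likelihoodRatio θ θ' x.1 x.2 - 1) ε :=
  ⟨(measurable_likelihoodRatio hθ hθ').sub_const 1, fun x => hε x.1 x.2⟩

theorem integral_kernel_eq_integral_mul_likelihoodRatio (hθ : θ ∈ π.Θ) (hθ' : θ' ∈ π.Θ) (s : S)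
    (f : A → ℝ) :
    ∫ a, f a ∂(π.kernel θ' s) = ∫ a, f a * π.likelihoodRatio θ θ' s a ∂(π.kernel θ s) := by
  have hmeas : ∀ θ ∈ π.Θ, Measurable fun a => ENNReal.ofReal (π.density θ s a) := fun θ hθ =>
    ((π.measurable_density θ hθ).comp measurable_prodMk_left).ennreal_ofReal
  rw [kernel_apply hθ, kernel_apply hθ',
    integral_withDensity_eq_integral_toReal_smul (hmeas θ' hθ') (by simp),
    integral_withDensity_eq_integral_toReal_smul (hmeas θ hθ) (by simp)]
  refine integral_congr_ae (ae_of_all _ fun a => ?_)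
  have hpos := π.density_pos θ hθ s a
  simp only [ENNReal.toReal_ofReal hpos.le, ENNReal.toReal_ofReal (π.density_pos θ' hθ' s a).le,
    likelihoodRatio, smul_eq_mul]
  field_simp

theorem tendsto_slope_likelihoodRatio (hθ : θ ∈ π.Θ) {s : S} {a : A}
    (hdiff : LineDifferentiableAt ℝ (π.logDensity s a) θ (EuclideanSpace.single i 1)) :
    Tendsto (fun h : ℝ => h⁻¹ *
        (π.likelihoodRatio θ (θ + h • EuclideanSpace.single i (1 : ℝ)) s a - 1))
      (𝓝[≠] 0) (𝓝 (π.score i θ s a)) := by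
  have hlog : HasDerivAt
      (fun h : ℝ => π.logDensity s a (θ + h • EuclideanSpace.single i 1)) (π.score i θ s a) 0 :=
    hdiff.hasLineDerivAt
  have hexp := (hlog.sub_const (π.logDensity s a θ)).exp
  simp only [zero_smul, add_zero, sub_self, Real.exp_zero, one_mul] at hexp
  refine hexp.tendsto_slope_zero.congr' ?_
  filter_upwards [nhdsWithin_le_nhds (eventually_add_smul_mem_Θ hθ (EuclideanSpace.single i 1))]
    with h hmem
  simp [likelihoodRatio_eq_exp hθ hmem]

theorem measurable_score (hθ : θ ∈ π.Θ)
    (hdiff : ∀ s a, LineDifferentiableAt ℝ (π.logDensity s a) θ (EuclideanSpace.single i 1)) :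
    Measurable fun x : S × A => π.score i θ x.1 x.2 := by
  have hΘ : ∀ᶠ h : ℝ in 𝓝[≠] 0, θ + h • EuclideanSpace.single i (1 : ℝ) ∈ π.Θ :=
    nhdsWithin_le_nhds (eventually_add_smul_mem_Θ hθ _)
  obtain ⟨h, hlim, hmem⟩ := exists_seq_forall_of_frequently hΘ.frequently
  exact measurable_of_tendsto_metrizable
    (fun n => ((measurable_likelihoodRatio hθ (hmem n)).sub_const 1).const_mul (h n)⁻¹)
    (tendsto_pi_nhds.2 fun x => (tendsto_slope_likelihoodRatio hθ (hdiff x.1 x.2)).comp hlim)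

/-- The `i`-th partial derivative of the log-density exists near `θ` and is bounded there, uniformly
in the state-action pair. This is the regularity under which the policy gradient theorem holds. -/
def HasLocallyBoundedScore (π : ParametricPolicy m S A) (i : Fin m)
    (θ : EuclideanSpace ℝ (Fin m)) : Prop :=
  ∃ D : ℝ, ∀ᶠ θ' in 𝓝 θ, ∀ s a,
    LineDifferentiableAt ℝ (π.logDensity s a) θ' (EuclideanSpace.single i 1) ∧
      |π.score i θ' s a| ≤ D

theorem HasLocallyBoundedScore.lineDifferentiableAt (hloc : π.HasLocallyBoundedScore i θ) (s : S)
    (a : A) : LineDifferentiableAt ℝ (π.logDensity s a) θ (EuclideanSpace.single i 1) :=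
  let ⟨_, hD⟩ := hloc
  (hD.self_of_nhds s a).1

theorem HasLocallyBoundedScore.isBoundedMeasurable_score (hloc : π.HasLocallyBoundedScore i θ)
    (hθ : θ ∈ π.Θ) : ∃ B, IsBoundedMeasurable (fun x : S × A => π.score i θ x.1 x.2) B :=
  let ⟨D, hD⟩ := hloc
  ⟨D, measurable_score hθ hloc.lineDifferentiableAt, fun x => (hD.self_of_nhds x.1 x.2).2⟩

theorem HasLocallyBoundedScore.exists_abs_likelihoodRatio_sub_one_le
    (hloc : π.HasLocallyBoundedScore i θ) (hθ : θ ∈ π.Θ) :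
    ∃ K : ℝ, ∀ᶠ h : ℝ in 𝓝 0, ∀ s a,
      |π.likelihoodRatio θ (θ + h • EuclideanSpace.single i (1 : ℝ)) s a - 1| ≤ K * |h| := by
  obtain ⟨D, hD⟩ := hloc
  obtain ⟨r, hr, hball⟩ := Metric.eventually_nhds_iff_ball.1
    ((tendsto_add_smul_nhds θ (EuclideanSpace.single i (1 : ℝ))).eventually hD)
  have hsmall : ∀ᶠ h : ℝ in 𝓝 0, D * |h| < 1 :=
    ContinuousAt.eventually_lt (by fun_prop) (by fun_prop) (by simp)
  refine ⟨2 * D, ?_⟩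
  filter_upwards [Metric.ball_mem_nhds 0 hr, hsmall, eventually_add_smul_mem_Θ hθ _]
    with h hhr hDh hmem s a
  have hlog := abs_sub_le_of_abs_lineDeriv_le (convex_ball (0 : ℝ) r) (Metric.mem_ball_self hr) hhr
    (fun t ht => (hball t ht s a).1) (fun t ht => (hball t ht s a).2)
  rw [likelihoodRatio_eq_exp hθ hmem]
  exact (Real.abs_exp_sub_one_le (hlog.trans hDh.le)).trans (by linarith)

end ParametricPolicy

namespace CMDP

variable {Ω S A : Type*} [MeasurableSpace S] [MeasurableSpace A] {m : ℕ}
  (M : CMDP Ω S A) (ω : Ω) {π : ParametricPolicy m S A} {θ θ' : EuclideanSpace ℝ (Fin m)}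
  {i : Fin m} {ε : ℝ}

theorem V_sub_integral_Q (hθ : θ ∈ π.Θ) (hθ' : θ' ∈ π.Θ)
    (hε : ∀ s a, |π.likelihoodRatio θ θ' s a - 1| ≤ ε) (s : S) :
    M.V π ω θ' s - ∫ a, M.Q π ω θ' s a ∂(π.kernel θ s)
      = ∫ a, M.Q π ω θ' s a * (π.likelihoodRatio θ θ' s a - 1) ∂(π.kernel θ s) := by
  have := π.isMarkovKernel_kernel hθ
  have := π.isMarkovKernel_kernel hθ'
  have hQ := (M.isBoundedMeasurable_Q π ω θ').comp (measurable_prodMk_left (x := s))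
  have hr := (π.isBoundedMeasurable_likelihoodRatio_sub_one hθ hθ' hε).comp
    (measurable_prodMk_left (x := s))
  rw [V, π.integral_kernel_eq_integral_mul_likelihoodRatio hθ hθ', sub_eq_iff_eq_add,
    ← integral_add ((hQ.mul hr).integrable _) (hQ.integrable _)]
  simp only [mul_sub, mul_one, sub_add_cancel]

theorem γ_mul_integral_stepS_V_sub_V [IsMarkovKernel (π.kernel θ)] [IsMarkovKernel (π.kernel θ')]
    (s : S) :
    M.γ * ∫ y, (M.V π ω θ' y - M.V π ω θ y) ∂(M.stepS π ω θ s)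
      = ∫ a, M.Q π ω θ' s a ∂(π.kernel θ s) - M.V π ω θ s := by
  have hV := M.isBoundedMeasurable_V π ω θ
  have hV' := M.isBoundedMeasurable_V π ω θ'
  have hQ := (M.isBoundedMeasurable_Q π ω θ).comp (measurable_prodMk_left (x := s))
  have hQ' := (M.isBoundedMeasurable_Q π ω θ').comp (measurable_prodMk_left (x := s))
  rw [M.integral_stepS π ω θ (hV'.sub hV), V, ← integral_sub (hQ'.integrable _) (hQ.integrable _),
    ← integral_const_mul]
  congr 1 with a
  rw [M.Q_eq_add_integral_V, M.Q_eq_add_integral_V,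
    integral_sub (hV'.integrable _) (hV.integrable _)]
  ring

/-- The performance difference lemma of Kakade and Langford, with importance weights in place of
the advantage function. -/
theorem expectedReturn_sub_expectedReturn [IsMarkovKernel (π.kernel θ)] (hθ : θ ∈ π.Θ)
    (hθ' : θ' ∈ π.Θ) (hε : ∀ s a, |π.likelihoodRatio θ θ' s a - 1| ≤ ε) :
    (1 - M.γ) * M.expectedReturn π ω θ' - (1 - M.γ) * M.expectedReturn π ω θ
      = ∫ x, M.Q π ω θ' x.1 x.2 * (π.likelihoodRatio θ θ' x.1 x.2 - 1)
          ∂(M.occupancy π ω θ ⊗ₘ π.kernel θ) := by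
  have := π.isMarkovKernel_kernel hθ'
  have hV := M.isBoundedMeasurable_V π ω θ
  have hV' := M.isBoundedMeasurable_V π ω θ'
  have hratio := π.isBoundedMeasurable_likelihoodRatio_sub_one hθ hθ' hε
  rw [← mul_sub, expectedReturn, expectedReturn,
    ← integral_sub (hV'.integrable _) (hV.integrable _),
    ← M.integral_occupancy_sub π ω θ (hV'.sub hV),
    ((M.isBoundedMeasurable_Q π ω θ').mul hratio).integral_compProd]
  congr 1 with s
  rw [γ_mul_integral_stepS_V_sub_V, sub_sub_sub_cancel_right, M.V_sub_integral_Q ω hθ hθ' hε]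

theorem abs_Q_sub_le_of_abs_likelihoodRatio_sub_one_le (hθ : θ ∈ π.Θ) (hθ' : θ' ∈ π.Θ)
    (hε : ∀ s a, |π.likelihoodRatio θ θ' s a - 1| ≤ ε) (s : S) (a : A) :
    |M.Q π ω θ' s a - M.Q π ω θ s a|
      ≤ M.γ * (M.Rmax / (1 - M.γ) * ε) / (1 - M.γ) := by
  have := π.isMarkovKernel_kernel hθ
  have := π.isMarkovKernel_kernel hθ'
  have hQ' := M.isBoundedMeasurable_Q π ω θ'
  have hr := π.isBoundedMeasurable_likelihoodRatio_sub_one hθ hθ' hε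
  refine abs_sub_le_of_bellman_residual M.γ_nonneg M.γ_lt_one hQ' (M.isBoundedMeasurable_Q π ω θ)
    (M.Q_bellman π ω θ) (fun x => ?_) (s, a)
  rw [M.Q_bellman π ω θ' x, add_sub_add_left_eq_sub, ← mul_sub, abs_mul, abs_of_nonneg M.γ_nonneg,
    integral_stepSA_Q, stepSA_apply, hQ'.integral_compProd]
  refine mul_le_mul_of_nonneg_left ((M.isBoundedMeasurable_V π ω θ').abs_integral_sub_le
    (hQ'.integral_kernel_prod (π.kernel θ)) (fun s => ?_) _) M.γ_nonneg
  rw [M.V_sub_integral_Q ω hθ hθ' hε]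
  exact ((hQ'.mul hr).comp measurable_prodMk_left).abs_integral_le _

theorem tendsto_Q (hθ : θ ∈ π.Θ) (hloc : π.HasLocallyBoundedScore i θ) (s : S) (a : A) :
    Tendsto (fun h : ℝ => M.Q π ω (θ + h • EuclideanSpace.single i 1) s a) (𝓝 0)
      (𝓝 (M.Q π ω θ s a)) := by
  obtain ⟨K, hK⟩ := hloc.exists_abs_likelihoodRatio_sub_one_le hθ
  refine tendsto_iff_dist_tendsto_zero.2 (squeeze_zero' (.of_forall fun _ => dist_nonneg)
    (g := fun h => M.γ * (M.Rmax / (1 - M.γ) * (K * |h|)) / (1 - M.γ)) ?_ ?_)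
  · filter_upwards [hK, π.eventually_add_smul_mem_Θ hθ _] with h hKh hmem
    exact M.abs_Q_sub_le_of_abs_likelihoodRatio_sub_one_le ω hθ hmem hKh s a
  · exact Continuous.tendsto' (by fun_prop) _ _ (by simp)

theorem hasLineDerivAt_expectedReturn (hθ : θ ∈ π.Θ) (hloc : π.HasLocallyBoundedScore i θ) :
    HasLineDerivAt ℝ (fun θ' => (1 - M.γ) * M.expectedReturn π ω θ')
      (M.policyGradient π i ω θ) θ (EuclideanSpace.single i 1) := by
  have := π.isMarkovKernel_kernel hθ
  obtain ⟨B, hB⟩ := hloc.isBoundedMeasurable_score hθ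
  obtain ⟨K, hK⟩ := hloc.exists_abs_likelihoodRatio_sub_one_le hθ
  set e : EuclideanSpace ℝ (Fin m) := EuclideanSpace.single i 1
  have hevent : ∀ᶠ h : ℝ in 𝓝[≠] 0, h ≠ 0 ∧ θ + h • e ∈ π.Θ ∧
      ∀ s a, |π.likelihoodRatio θ (θ + h • e) s a - 1| ≤ K * |h| :=
    eventually_mem_nhdsWithin.and
      (nhdsWithin_le_nhds ((π.eventually_add_smul_mem_Θ hθ e).and hK))
  have hslope : ∀ᶠ h : ℝ in 𝓝[≠] 0, IsBoundedMeasurable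
      (fun x : S × A => M.Q π ω (θ + h • e) x.1 x.2
        * (h⁻¹ * (π.likelihoodRatio θ (θ + h • e) x.1 x.2 - 1))) (M.Rmax / (1 - M.γ) * K) := by
    filter_upwards [hevent] with h ⟨hh, hmem, hKh⟩
    have := π.isMarkovKernel_kernel hmem
    have hr := (π.isBoundedMeasurable_likelihoodRatio_sub_one hθ hmem hKh).const_mul h⁻¹
    have hcancel : |h⁻¹| * (K * |h|) = K := by
      rw [mul_left_comm, ← abs_mul, inv_mul_cancel₀ hh, abs_one, mul_one]
    exact (M.isBoundedMeasurable_Q π ω (θ + h • e)).mul (hcancel ▸ hr)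
  rw [hasLineDerivAt_iff_tendsto_slope_zero, M.policyGradient_eq_integral_compProd π ω θ hB]
  refine (tendsto_integral_filter_of_dominated_convergence (fun _ => M.Rmax / (1 - M.γ) * K)
    (hslope.mono fun h hF => hF.measurable.aestronglyMeasurable)
    (hslope.mono fun h hF => ae_of_all _ hF.abs_le) (integrable_const _)
    (ae_of_all _ fun x => ?_)).congr' ?_
  · rw [eta, mul_comm]
    exact ((M.tendsto_Q ω hθ hloc x.1 x.2).mono_left nhdsWithin_le_nhds).mul
      (π.tendsto_slope_likelihoodRatio hθ (hloc.lineDifferentiableAt x.1 x.2))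
  · filter_upwards [hevent] with h ⟨_, hmem, hKh⟩
    rw [M.expectedReturn_sub_expectedReturn ω hθ hmem hKh, smul_eq_mul, ← integral_const_mul]
    simp only [mul_left_comm]

end CMDP

theorem lipGrad_mul (γ Rmax LP Lr Lπ LωP Lωr B Lscore c : ℝ) :
    lipGrad γ Rmax LP Lr Lπ (LωP * c) (Lωr * c) B Lscore
      = lipGrad γ Rmax LP Lr Lπ LωP Lωr B Lscore * c := by
  simp only [lipGrad, lipDelta, lipCtxQ]
  ring

theorem coe_mul_edist_eq_ofReal {X : Type*} [PseudoMetricSpace X] (L : ℝ≥0) (x y : X) :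
    L * edist x y = ENNReal.ofReal (L * dist x y) := by
  rw [edist_dist, ENNReal.ofReal_mul L.coe_nonneg, ENNReal.ofReal_coe_nnreal]

theorem CMDP.IsContextLipschitz.kantorovichLE_P {Ω S A : Type*} [MetricSpace Ω] [MetricSpace S]
    [MeasurableSpace S] [MeasurableSpace A] {M : CMDP Ω S A} {LωP Lωr : ℝ≥0}
    (hctx : M.IsContextLipschitz LωP Lωr) (ω ω' : Ω) (x : S × A) :
    KantorovichLE dist (M.P ω x) (M.P ω' x) (LωP * dist ω ω') :=
  .of_kantorovich_le (by positivity)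
    ((hctx.transition ω ω' x.1 x.2).trans_eq (coe_mul_edist_eq_ofReal LωP ω ω'))

section Hypotheses

variable {Ω S A : Type*} [MetricSpace S] [MeasurableSpace S] [MetricSpace A] [MeasurableSpace A]
  {m : ℕ} {M : CMDP Ω S A} {π : ParametricPolicy m S A} {θ : EuclideanSpace ℝ (Fin m)}

theorem CMDP.IsLipschitz.lipschitzKernel_P {LP Lr : Ω → ℝ≥0} (hM : M.IsLipschitz LP Lr) (ω : Ω) :
    LipschitzKernel sumDist dist (LP ω) (M.P ω) := fun x y => by
  refine .of_kantorovich_le (by unfold sumDist; positivity)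
    ((hM.transition ω x.1 y.1 x.2 y.2).trans_eq ?_)
  rw [mul_add, coe_mul_edist_eq_ofReal, coe_mul_edist_eq_ofReal,
    ← ENNReal.ofReal_add (by positivity) (by positivity), ← mul_add, sumDist]

theorem ParametricPolicy.IsLipschitz.lipschitzKernel_kernel
    {Lstate Lparam : EuclideanSpace ℝ (Fin m) → ℝ≥0} (hπ : π.IsLipschitz Lstate Lparam)
    (hθ : θ ∈ π.Θ) : LipschitzKernel dist dist (Lstate θ) (π.kernel θ) := fun s s' =>
  have := π.isMarkovKernel_kernel hθ
  .of_kantorovich_le (by positivity)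
    ((hπ.state θ hθ s s').trans_eq (coe_mul_edist_eq_ofReal (Lstate θ) s s'))

theorem ParametricPolicy.HasLipschitzScore.hasLocallyBoundedScore
    {B : EuclideanSpace ℝ (Fin m) → Fin m → ℝ}
    {Lsa Lparam : EuclideanSpace ℝ (Fin m) → Fin m → ℝ≥0}
    (hscore : π.HasLipschitzScore B Lsa Lparam) (hθ : θ ∈ π.Θ) (i : Fin m) :
    π.HasLocallyBoundedScore i θ := by
  refine ⟨B θ i + Lparam θ i, ?_⟩
  filter_upwards [π.isOpen_Θ.mem_nhds hθ, Metric.closedBall_mem_nhds θ one_pos]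
    with θ' hθ' hdist s a
  refine ⟨hscore.differentiable θ' hθ' i s a, ?_⟩
  calc |π.score i θ' s a| ≤ |π.score i θ s a| + |π.score i θ s a - π.score i θ' s a| := by
        linarith [abs_sub_abs_le_abs_sub (π.score i θ' s a) (π.score i θ s a),
          abs_sub_comm (π.score i θ' s a) (π.score i θ s a)]
    _ ≤ B θ i + Lparam θ i * dist θ θ' :=
        add_le_add (hscore.bounded θ hθ i s a) (hscore.param θ hθ θ' hθ' i s a)
    _ ≤ B θ i + Lparam θ i := by
        gcongr
        exact mul_le_of_le_one_right (Lparam θ i).coe_nonneg (dist_comm θ θ' ▸ hdist)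

end Hypotheses

theorem theorem2_general {Ω S A : Type*} [PseudoMetricSpace S] [MeasurableSpace S]
    [PseudoMetricSpace A] [MeasurableSpace A] {m : ℕ} (M : CMDP Ω S A)
    (π : ParametricPolicy m S A) {LP Lr Lπ Lscore : ℝ≥0} {B : ℝ} {εP εr : Ω → ℝ}
    {θ : EuclideanSpace ℝ (Fin m)} (hθ : θ ∈ π.Θ) {ω : Ω} {i : Fin m}
    (hP : LipschitzKernel sumDist dist LP (M.P ω)) (hR : LipschitzFor sumDist Lr (M.R ω))
    (hPctx : ∀ ω' x, KantorovichLE dist (M.P ω x) (M.P ω' x) (εP ω'))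
    (hRctx : ∀ ω' x, |M.R ω x - M.R ω' x| ≤ εr ω')
    (hπ : LipschitzKernel dist dist Lπ (π.kernel θ)) (hloc : π.HasLocallyBoundedScore i θ)
    (hB : ∀ s a, |π.score i θ s a| ≤ B)
    (hscore : LipschitzFor sumDist Lscore fun x : S × A => π.score i θ x.1 x.2)
    (hω : M.γ * LP * (1 + Lπ) < 1) :
    (∀ ω' : Ω, HasLineDerivAt ℝ (fun θ' => (1 - M.γ) * M.expectedReturn π ω' θ')
      (M.policyGradient π i ω' θ) θ (EuclideanSpace.single i 1)) ∧
    ∀ ω' : Ω, |M.policyGradient π i ω θ - M.policyGradient π i ω' θ|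
      ≤ lipGrad M.γ M.Rmax LP Lr Lπ (εP ω') (εr ω') B Lscore := by
  have := π.isMarkovKernel_kernel hθ
  have hbdd : IsBoundedMeasurable (fun x : S × A => π.score i θ x.1 x.2) B :=
    ⟨π.measurable_score hθ hloc.lineDifferentiableAt, fun x => hB x.1 x.2⟩
  exact ⟨fun ω' => M.hasLineDerivAt_expectedReturn ω' hθ hloc, fun ω' =>
    CMDP.abs_policyGradient_sub_le hP hR hπ hω (hPctx ω') (hRctx ω') hbdd hscore⟩

theorem theorem2
    {Ω S A : Type*} [MetricSpace Ω]
    [MetricSpace S] [MeasurableSpace S] [BorelSpace S]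
    [MetricSpace A] [MeasurableSpace A] [BorelSpace A]
    {m : ℕ} (M : CMDP Ω S A) (π : ParametricPolicy m S A)
    (LP Lr : Ω → ℝ≥0) (LωP Lωr : ℝ≥0)
    (Lπ Lπparam : EuclideanSpace ℝ (Fin m) → ℝ≥0)
    (B : EuclideanSpace ℝ (Fin m) → Fin m → ℝ)
    (Lscore Lscoreparam : EuclideanSpace ℝ (Fin m) → Fin m → ℝ≥0)
    (hM : M.IsLipschitz LP Lr)
    (hctx : M.IsContextLipschitz LωP Lωr)
    (hπ : π.IsLipschitz Lπ Lπparam)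
    (hscore : π.HasLipschitzScore B Lscore Lscoreparam)
    (θ : EuclideanSpace ℝ (Fin m)) (hθ : θ ∈ π.Θ)
    (ω : Ω) (hω : M.γ * LP ω * (1 + Lπ θ) < 1) (i : Fin m) :
    -- the normalized return has an `i`-th partial derivative at `θ`, in every context
    (∀ ω' : Ω, HasLineDerivAt ℝ (fun θ' => (1 - M.γ) * M.expectedReturn π ω' θ')
      (M.policyGradient π i ω' θ) θ (EuclideanSpace.single i 1)) ∧
    -- and this derivative is Lipschitz in the context
    ∀ ω' : Ω, |M.policyGradient π i ω θ - M.policyGradient π i ω' θ| ≤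
      lipGrad M.γ M.Rmax (LP ω) (Lr ω) (Lπ θ) LωP Lωr (B θ i) (Lscore θ i) * dist ω ω' := by
  simp only [← lipGrad_mul]
  exact theorem2_general M π hθ (hM.lipschitzKernel_P ω) (fun x y => hM.reward ω x.1 y.1 x.2 y.2)
    (hctx.kantorovichLE_P ω) (fun ω' x => hctx.reward ω ω' x.1 x.2) (hπ.lipschitzKernel_kernel hθ)
    (hscore.hasLocallyBoundedScore hθ i) (hscore.bounded θ hθ i)
    (fun x y => hscore.stateAction θ hθ i x.1 y.1 x.2 y.2) hω
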